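/- Conventions. All actions are on the right. For $F\subseteq\Gamma$, a local embedding of $F$ into a group $\Delta$ is an injective map $\pi:F\to\Delta$ such that $\pi(gh)=\pi(g)\pi(h)$ whenever $g,h,gh\in F$. For actions $\Gamma\curvearrowright\Omega$, $\Delta\curvearrowright X$ and subsets $F\subseteq\Gamma$, $\Sigma\subseteq\Omega$, a local embedding of $(F,\Sigma)$ into $(\Delta,X)$ is a pair $(\pi,\theta)$ of a local embedding $\pi:F\to\Delta$ and an injective map $\theta:\Sigma\to X$ such that $\theta(\omega g)=\theta(\omega)\pi(g)$ whenever $g\in F$, $\omega\in\Sigma$ and $\omega g\in\Sigma$. A group $\Gamma$ is LEF if every finite $F\subseteq\Gamma$ has a local embedding into a finite group; an action $\Gamma\curvearrowright\Omega$ is LEF if for all finite $F\subseteq\Gamma$, $\Sigma\subseteq\Omega$ the pair $(F,\Sigma)$ has a local embedding into some $(Q,X)$ with $Q$ a finite group acting on a finite set $X$. For $S\subseteq\Gamma$ and $\omega\in\Omega$, let $B_{S,\omega}(n)$ be the closed ball of radius $n$ around $\omega$ in the path-metric of the Schreier graph (vertices $\Omega$, an edge joining $\omega'$ and $\omega's$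 for $\omega'\in\Omega$, $s\in S$; edges may be traversed in both directions), and let $B_S(n)$ be the ball around $1$ for the right regular action of $\Gamma$ on itself. Put $\gamma_{\Gamma,\Omega}^{S,\omega}(n)=|B_{S,\omega}(n)|$ and $\gamma_\Gamma^S(n)=|B_S(n)|$. For a finite generating set $S$ of $\Gamma$, the LEF growth $\mathcal L_\Gamma^S(n)$ is the least order of a finite group into which $B_S(n)$ has a local embedding ($\infty$ if there is none). For functions $f_1,f_2$ on $\mathbb N=\{0,1,2,\dots\}$ write $f_1\preceq f_2$ if there is a real constant $C>0$ with $f_1(\lfloor x\rfloor)\le f_2(\lfloor Cx\rfloor)$ for all real $x>0$. Let $\mathrm{FSym}(\Omega)$ be the group of finitely supported permutations of $\Omega$, and $\mathcal S(\Gamma,\Omega)=\mathrm{FSym}(\Omega)\rtimes\Gamma$, where $\Gamma$ acts on $\mathrm{FSym}(\Omega)$ by conjugation through its action on $\Omega$; write $\mathcal S(\Gamma)=\mathcal S(\Gamma,\Gamma)$ for the right regular action. **Theorem.** (1) Let $\Gamma$ be a LEF group with a finite generating set $S$, and let $\Gamma\curvearrowright\Omega$ be a transitive LEF action. Then $\mathcal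 S(\Gamma,\Omega)$ is finitely generated and LEF. Moreover, for every $\omega_0\in\Omega$ and every finite generating set $U$ of $\mathcal S(\Gamma,\Omega)$, $$\gamma_{\Gamma,\Omega}^{S,\omega_0}(n)!\ \preceq\ \mathcal L_{\mathcal S(\Gamma,\Omega)}^{U}(n),$$ and if, for each $n\in\mathbb N$, $Q_n$ is a finite group acting on a finite set $X_n$ and $(\pi_n,\theta_n)$ is a local embedding of $\big(B_S(n),B_{S,\omega_0}(n)\big)$ into $(Q_n,X_n)$, then $$\mathcal L_{\mathcal S(\Gamma,\Omega)}^{U}(n)\ \preceq\ |X_n|!\,|Q_n|.$$ (2) In particular, let $\Gamma$ be a LEF group with a finite generating set $S$. Then $\mathcal S(\Gamma)$ is finitely generated and LEF, and for every finite generating set $U$ of $\mathcal S(\Gamma)$, $$\gamma_\Gamma^S(n)!\ \preceq\ \mathcal L_{\mathcal S(\Gamma)}^{U}(n),$$ and, if $\Gamma$ is infinite, also $$\mathcal L_{\mathcal S(\Gamma)}^{U}(n)\ \preceq\ \mathcal L_\Gamma^S(n)!.$$ -/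

import Mathlib

open scoped RightActions

namespace LEF

section Embeddings

variable {Γ Δ Ω X : Type*} [Group Γ] [Group Δ]

/-- `π` restricts to a local embedding of `F ⊆ Γ` into `Δ`: an injective partial homomorphism.
Only the values of `π` on `F` matter. -/
def IsLocalEmbedding (F : Set Γ) (π : Γ → Δ) : Prop :=
  (∀ g ∈ F, ∀ h ∈ F, g * h ∈ F → π (g * h) = π g * π h) ∧ Set.InjOn π F

/-- `(π, θ)` restricts to a local embedding of `(F, T)` into `(Δ, X)`, for right actions of `Γ` on
`Ω ⊇ T` and of `Δ` on `X`; here `ω <• g` is `ω` acted upon by `g` on the right. Only the values of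
`π` on `F` and of `θ` on `T` matter. -/
def IsLocalActionEmbedding [MulAction Γᵐᵒᵖ Ω] [MulAction Δᵐᵒᵖ X]
    (F : Set Γ) (T : Set Ω) (π : Γ → Δ) (θ : Ω → X) : Prop :=
  IsLocalEmbedding F π ∧ Set.InjOn θ T ∧
    ∀ g ∈ F, ∀ ω ∈ T, ω <• g ∈ T → θ (ω <• g) = θ ω <• π g

end Embeddings

/-- The group `Γ` is locally embeddable into finite groups. -/
def IsLEF (Γ : Type*) [Group Γ] : Prop :=
  ∀ F : Set Γ, F.Finite →
    ∃ (Q : Type) (_ : Group Q) (_ : Finite Q) (π : Γ → Q), IsLocalEmbedding F π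

/-- The right action of `Γ` on `Ω` is locally embeddable into finite actions. -/
def IsLEFAction (Γ Ω : Type*) [Group Γ] [MulAction Γᵐᵒᵖ Ω] : Prop :=
  ∀ (F : Set Γ) (T : Set Ω), F.Finite → T.Finite →
    ∃ (Q : Type) (_ : Group Q) (_ : Finite Q) (X : Type) (_ : Finite X) (_ : MulAction Qᵐᵒᵖ X)
      (π : Γ → Q) (θ : Ω → X), IsLocalActionEmbedding F T π θ

section Growth

variable {Γ Ω : Type*} [Group Γ] [MulAction Γᵐᵒᵖ Ω]

/-- The closed ball of radius `n` around `ω₀` in the path-metric of the Schreier graph, whose edges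
join `ω` and `ω <• s` for `s ∈ S` (edges may be traversed in both directions). -/
def schreierBall (S : Set Γ) (ω₀ : Ω) : ℕ → Set Ω
  | 0 => {ω₀}
  | n + 1 => schreierBall S ω₀ n ∪
      {ω | ∃ ω' ∈ schreierBall S ω₀ n, ∃ s ∈ S, ω = ω' <• s ∨ ω' = ω <• s}

/-- The ball of radius `n` around the identity in the Cayley graph, that is, in the Schreier graph
of the right regular action. -/
def ball (S : Set Γ) (n : ℕ) : Set Γ := schreierBall S (1 : Γ) n

/-- The growth function of the Schreier graph (a finite cardinality when `S` is finite). -/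
noncomputable def schreierGrowth (S : Set Γ) (ω₀ : Ω) (n : ℕ) : ℕ := (schreierBall S ω₀ n).ncard

/-- The word growth function of the group `Γ`. -/
noncomputable def wordGrowth (S : Set Γ) (n : ℕ) : ℕ := (ball S n).ncard

/-- The LEF growth of `Γ` with respect to `S`: the least order of a finite group into which the
ball of radius `n` locally embeds, and `⊤` if there is none. -/
noncomputable def lefGrowth (S : Set Γ) (n : ℕ) : ℕ∞ :=
  sInf {k : ℕ∞ | ∃ (Q : Type) (_ : Group Q) (_ : Finite Q) (π : Γ → Q),
    IsLocalEmbedding (ball S n) π ∧ k = (Nat.card Q : ℕ∞)}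

end Growth

/-- The factorial on `ℕ∞`, with `⊤! = ⊤`. -/
noncomputable def factorial (k : ℕ∞) : ℕ∞ := ENat.map Nat.factorial k

/-- Comparison of growth functions: `f ⪯ g` if for some constant `C > 0` one has
`f x ≤ g (C x)` for all real `x > 0`, where functions on `ℕ` are extended to be constant on each
interval `[n, n + 1)`. -/
def Preceq (f g : ℕ → ℕ∞) : Prop :=
  ∃ C : ℝ, 0 < C ∧ ∀ x : ℝ, 0 < x → f ⌊x⌋₊ ≤ g ⌊C * x⌋₊

/-- The group of finitely supported permutations of `Ω`. -/
def FSym (Ω : Type*) : Subgroup (Equiv.Perm Ω) where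
  carrier := {σ | {ω | σ ω ≠ ω}.Finite}
  one_mem' := by simp
  mul_mem' := by
    intro σ τ hσ hτ
    refine (hσ.union hτ).subset fun ω hω => ?_
    by_contra h
    simp only [Set.mem_union, Set.mem_ofPred_eq, not_or, not_not] at h
    exact hω (by rw [Equiv.Perm.mul_apply, h.2, h.1])
  inv_mem' := by
    intro σ hσ
    refine Set.Finite.subset hσ fun ω hω h => hω ?_
    rw [Equiv.Perm.inv_eq_iff_eq]
    exact h.symm

instance (Ω : Type*) : (FSym Ω).Normal where
  conj_mem := by
    intro σ hσ τ
    refine (Set.Finite.image τ hσ).subset fun ω hω => ⟨τ⁻¹ ω, fun h => hω ?_, by simp⟩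
    rw [Equiv.Perm.mul_apply, Equiv.Perm.mul_apply, h]
    simp

section Enrichment

variable (Γ Ω : Type*) [Group Γ] [MulAction Γᵐᵒᵖ Ω]

/-- The permutation `ω ↦ ω <• g⁻¹` of `Ω`. Permutations in Mathlib act on the left, so the inverse
makes this a homomorphism. -/
def permHom : Γ →* Equiv.Perm Ω :=
  (MulAction.toPermHom Γᵐᵒᵖ Ω).comp (MulEquiv.inv' Γ).toMonoidHom

/-- The automorphisms of `FSym Ω` induced by the action: `g` sends `σ` to the permutation
`ω ↦ σ (ω <• g) <• g⁻¹`, the conjugate of `σ` by `g`. -/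
def conjHom : Γ →* MulAut (FSym Ω) := MulAut.conjNormal.comp (permHom Γ Ω)

theorem conjHom_apply (g : Γ) (σ : FSym Ω) (ω : Ω) :
    (conjHom Γ Ω g σ : Equiv.Perm Ω) ω = (σ : Equiv.Perm Ω) (ω <• g) <• g⁻¹ := by
  simp [conjHom, permHom, MulAut.conjNormal_apply]

/-- The symmetric enrichment `FSym Ω ⋊ Γ` of the right action of `Γ` on `Ω`. Permutations are
composed as functions; composing them in the other order gives an isomorphic group, through
`(σ, g) ↦ (σ⁻¹, g)`. -/
abbrev SymEnrichment : Type _ := FSym Ω ⋊[conjHom Γ Ω] Γ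

end Enrichment

end LEF

/-!
Let `S` generate `Γ`, acting transitively on `Ω ∋ ω₀`.

*Short transpositions.* If `ω = ω' <• s`, then conjugating the transposition `(ω₀ ω')` by `s` gives
`(ω₀s ω)`, and conjugating this by `(ω₀ ω₀s)` gives `(ω₀ ω)`. Hence the elements of `S` and the
finitely many transpositions `(ω₀ ω₀s^±1)` produce `(ω₀ ω)`, for `ω` at distance `n` from `ω₀`, as
a word of length at most `4n` (`inl_transposition_mem_ball`). As transpositions generate `FSym Ω`,
the symmetric enrichment is finitely generated (`fg_symEnrichment`).

*Lower bound.* A local embedding of a sufficiently large ball into a finite group `Q` is thus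
injective on the transpositions of points of the ball `B` of radius `n` in `Ω`, and respects the
relations saying how they conjugate one another. Therefore every permutation `σ` of `B` is induced
on the images of the transpositions by conjugation with an element of `Q`. For `|B| ≥ 3` the
conjugation determines `σ`, so `|Q| ≥ |B|!` (`factorial_card_le_of_transposition_like`).

*Upper bound.* An element `(σ, g)` of length at most `n` has `g` of length at most `c n` and `σ`
supported in the ball of radius `c n` (`exists_right_mem_ball_and_left_fixes`). Given a local
embedding `(π, θ)` of slightly larger balls into `(Q, X)`, transporting `σ` along `θ` and applying
`π` to `g` is a local embedding into `FSym X ⋊ Q`, of order `|X|! |Q|`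
(`isLocalEmbedding_enrichmentMap`). The same map shows that the enrichment of a LEF action is LEF.

*Regular actions.* A local embedding of groups is also one of the regular actions. The factor `|Q|`
is then avoided for infinite `Γ` by composing with the action of `FSym Q ⋊ Q` on `Q`: since balls
grow strictly, some point of `Q` lies in the image of a ball but outside the transported supports,
and as `Q` acts freely, what an element does to this point reveals its component in `Q`
(`isLocalEmbedding_enrichmentPerm`).
-/

namespace LEF

/-! ### Balls in Schreier graphs and Cayley graphs -/

section Balls

variable {Γ Ω : Type*} [Group Γ] [MulAction Γᵐᵒᵖ Ω]

theorem rsmul_mul (ω : Ω) (g h : Γ) : ω <• (g * h) = (ω <• g) <• h := by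
  rw [MulOpposite.op_mul, mul_smul]

theorem rsmul_inv_rsmul (ω : Ω) (g : Γ) : (ω <• g⁻¹) <• g = ω := by
  rw [← rsmul_mul]; simp

theorem rsmul_rsmul_inv (ω : Ω) (g : Γ) : (ω <• g) <• g⁻¹ = ω := by
  rw [← rsmul_mul]; simp

theorem schreierBall_mono (S : Set Γ) (ω₀ : Ω) : Monotone (schreierBall S ω₀) :=
  monotone_nat_of_le_succ fun _ => Set.subset_union_left

theorem ball_mono (S : Set Γ) : Monotone (ball S) := schreierBall_mono S 1

theorem mem_schreierBall_succ {S : Set Γ} {ω₀ ω : Ω} {n : ℕ} :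
    ω ∈ schreierBall S ω₀ (n + 1) ↔ ω ∈ schreierBall S ω₀ n ∨
      ∃ ω' ∈ schreierBall S ω₀ n, ∃ s ∈ S, ω = ω' <• s ∨ ω = ω' <• s⁻¹ := by
  have key : ∀ (ω' : Ω) (s : Γ), ω' = ω <• s ↔ ω = ω' <• s⁻¹ := fun ω' s =>
    ⟨fun h => by rw [h, rsmul_rsmul_inv], fun h => by rw [h, rsmul_inv_rsmul]⟩
  simp only [← key]
  rfl

theorem mem_ball_succ {S : Set Γ} {g : Γ} {n : ℕ} :
    g ∈ ball S (n + 1) ↔ g ∈ ball S n ∨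
      ∃ h ∈ ball S n, ∃ s ∈ S, g = h * s ∨ g = h * s⁻¹ :=
  mem_schreierBall_succ

theorem mem_ball_zero {S : Set Γ} {g : Γ} : g ∈ ball S 0 ↔ g = 1 := Iff.rfl

theorem self_mem_schreierBall (S : Set Γ) (ω₀ : Ω) (n : ℕ) : ω₀ ∈ schreierBall S ω₀ n :=
  schreierBall_mono S ω₀ (Nat.zero_le n) rfl

theorem one_mem_ball (S : Set Γ) (n : ℕ) : (1 : Γ) ∈ ball S n := self_mem_schreierBall S 1 n

theorem mem_ball_one {S : Set Γ} {s : Γ} (hs : s ∈ S) : s ∈ ball S 1 :=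
  mem_ball_succ.2 (Or.inr ⟨1, one_mem_ball S 0, s, hs, Or.inl (one_mul s).symm⟩)

theorem inv_mem_ball_one {S : Set Γ} {s : Γ} (hs : s ∈ S) : s⁻¹ ∈ ball S 1 :=
  mem_ball_succ.2 (Or.inr ⟨1, one_mem_ball S 0, s, hs, Or.inr (one_mul s⁻¹).symm⟩)

theorem rsmul_mem_schreierBall {S : Set Γ} {ω₀ ω : Ω} {g : Γ} {m n : ℕ}
    (hω : ω ∈ schreierBall S ω₀ m) (hg : g ∈ ball S n) :
    ω <• g ∈ schreierBall S ω₀ (m + n) := by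
  induction n generalizing g with
  | zero =>
    rw [mem_ball_zero.1 hg]
    simpa using hω
  | succ n ih =>
    rcases mem_ball_succ.1 hg with hg | ⟨h, hh, s, hs, rfl | rfl⟩
    · exact schreierBall_mono S ω₀ (Nat.le_succ _) (ih hg)
    · exact mem_schreierBall_succ.2 (Or.inr ⟨_, ih hh, s, hs, Or.inl (rsmul_mul _ _ _)⟩)
    · exact mem_schreierBall_succ.2 (Or.inr ⟨_, ih hh, s, hs, Or.inr (rsmul_mul _ _ _)⟩)

theorem mul_mem_ball {S : Set Γ} {g h : Γ} {m n : ℕ} (hg : g ∈ ball S m) (hh : h ∈ ball S n) :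
    g * h ∈ ball S (m + n) :=
  rsmul_mem_schreierBall hg hh

theorem inv_mem_ball {S : Set Γ} {g : Γ} {n : ℕ} (hg : g ∈ ball S n) : g⁻¹ ∈ ball S n := by
  induction n generalizing g with
  | zero =>
    rw [mem_ball_zero.1 hg, inv_one]
    exact one_mem_ball S 0
  | succ n ih =>
    rw [add_comm]
    rcases mem_ball_succ.1 hg with hg | ⟨h, hh, s, hs, rfl | rfl⟩
    · exact ball_mono S (Nat.le_add_left _ _) (ih hg)
    · rw [mul_inv_rev]
      exact mul_mem_ball (inv_mem_ball_one hs) (ih hh)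
    · rw [mul_inv_rev, inv_inv]
      exact mul_mem_ball (mem_ball_one hs) (ih hh)

theorem ball_subset_ball_mul {U V : Set Γ} {k : ℕ} (h : V ⊆ ball U k) (n : ℕ) :
    ball V n ⊆ ball U (k * n) := by
  induction n with
  | zero => exact fun g hg => hg
  | succ n ih =>
    intro g hg
    rcases mem_ball_succ.1 hg with hg | ⟨a, ha, s, hs, rfl | rfl⟩
    · exact ball_mono U (Nat.mul_le_mul_left k (Nat.le_succ n)) (ih hg)
    · exact mul_mem_ball (ih ha) (h hs)
    · exact mul_mem_ball (ih ha) (inv_mem_ball (h hs))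

theorem ball_subset_closure (S : Set Γ) (n : ℕ) : ball S n ⊆ Subgroup.closure S := by
  induction n with
  | zero =>
    intro g hg
    rw [mem_ball_zero.1 hg]
    exact one_mem _
  | succ n ih =>
    intro g hg
    rcases mem_ball_succ.1 hg with hg | ⟨a, ha, s, hs, rfl | rfl⟩
    · exact ih hg
    · exact mul_mem (ih ha) (Subgroup.subset_closure hs)
    · exact mul_mem (ih ha) (inv_mem (Subgroup.subset_closure hs))

theorem finite_schreierBall {S : Set Γ} (hS : S.Finite) (ω₀ : Ω) (n : ℕ) :
    (schreierBall S ω₀ n).Finite := by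
  induction n with
  | zero => exact Set.finite_singleton _
  | succ n ih =>
    refine (ih.union ((ih.image2 (fun ω s => ω <• s) hS).union
      (ih.image2 (fun ω s => ω <• s⁻¹) hS))).subset fun ω hω => ?_
    rcases mem_schreierBall_succ.1 hω with h | ⟨ω', h, s, hs, rfl | rfl⟩
    · exact Or.inl h
    · exact Or.inr (Or.inl ⟨ω', h, s, hs, rfl⟩)
    · exact Or.inr (Or.inr ⟨ω', h, s, hs, rfl⟩)

theorem exists_mem_ball {S : Set Γ} (hS : Subgroup.closure S = ⊤) (g : Γ) :
    ∃ n, g ∈ ball S n := by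
  have hg : g ∈ Subgroup.closure S := hS ▸ Subgroup.mem_top g
  induction hg using Subgroup.closure_induction with
  | mem s hs => exact ⟨1, mem_ball_one hs⟩
  | one => exact ⟨0, one_mem_ball S 0⟩
  | mul a b _ _ iha ihb =>
    obtain ⟨m, hm⟩ := iha
    obtain ⟨n, hn⟩ := ihb
    exact ⟨m + n, mul_mem_ball hm hn⟩
  | inv a _ ih =>
    obtain ⟨m, hm⟩ := ih
    exact ⟨m, inv_mem_ball hm⟩

theorem exists_mem_schreierBall [MulAction.IsPretransitive Γᵐᵒᵖ Ω] {S : Set Γ}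
    (hS : Subgroup.closure S = ⊤) (ω₀ ω : Ω) : ∃ n, ω ∈ schreierBall S ω₀ n := by
  obtain ⟨g, rfl⟩ := MulAction.exists_smul_eq Γᵐᵒᵖ ω₀ ω
  obtain ⟨n, hn⟩ := exists_mem_ball hS g.unop
  have := rsmul_mem_schreierBall (self_mem_schreierBall S ω₀ 0) hn
  rw [MulOpposite.op_unop] at this
  exact ⟨0 + n, this⟩

/-- A finite subset of the union of an increasing sequence of sets lies in one of them. -/
theorem _root_.Set.Finite.exists_subset_of_monotone {α : Type*} {T : Set α} (hT : T.Finite)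
    {B : ℕ → Set α} (hB : Monotone B) (h : ∀ a ∈ T, ∃ n, a ∈ B n) : ∃ n, T ⊆ B n := by
  choose! f hf using h
  obtain ⟨N, hN⟩ := (hT.image f).bddAbove
  exact ⟨N, fun a ha => hB (hN ⟨a, ha, rfl⟩) (hf a ha)⟩

/-- In an infinite group every ball is a proper subset of the next one. -/
theorem exists_mem_ball_succ_notMem [Infinite Γ] {S : Set Γ} (hS : S.Finite)
    (hgen : Subgroup.closure S = ⊤) (n : ℕ) : ∃ g ∈ ball S (n + 1), g ∉ ball S n := by
  by_contra! h
  have key : ∀ k, ball S (n + k) ⊆ ball S n := by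
    intro k
    induction k with
    | zero => exact subset_rfl
    | succ k ih =>
      intro g hg
      rcases mem_ball_succ.1 hg with hg | ⟨a, ha, s, hs, hg⟩
      · exact ih hg
      · exact h g (mem_ball_succ.2 (Or.inr ⟨a, ih ha, s, hs, hg⟩))
  refine Set.infinite_univ (α := Γ) ((finite_schreierBall hS (1 : Γ) n).subset fun g _ => ?_)
  obtain ⟨k, hk⟩ := exists_mem_ball hgen g
  exact key k (ball_mono S (Nat.le_add_left k n) hk)

end Balls

/-! ### LEF growth and comparison of growth functions -/

section LEFGrowth

variable {Γ : Type*} [Group Γ]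

theorem IsLocalEmbedding.mono {Δ : Type*} [Group Δ] {E F : Set Γ} {π : Γ → Δ}
    (hπ : IsLocalEmbedding F π) (h : E ⊆ F) : IsLocalEmbedding E π :=
  ⟨fun g hg k hk hgk => hπ.1 g (h hg) k (h hk) (h hgk), hπ.2.mono h⟩

/-- A finite group in any universe bears witness to `lefGrowth`. -/
theorem IsLocalEmbedding.exists_type {F : Set Γ} {Q : Type*} [Group Q] [Finite Q] {π : Γ → Q}
    (hπ : IsLocalEmbedding F π) :
    ∃ (R : Type) (_ : Group R) (_ : Finite R) (ρ : Γ → R),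
      IsLocalEmbedding F ρ ∧ Nat.card R = Nat.card Q := by
  let e : Shrink.{0} Q ≃* Q := Shrink.mulEquiv
  refine ⟨Shrink.{0} Q, inferInstance, Finite.of_equiv Q e.symm.toEquiv, fun g => e.symm (π g),
    ⟨fun g hg h hh hgh => ?_, fun g hg h hh eq => ?_⟩, Nat.card_congr e.toEquiv⟩
  · simp only [hπ.1 g hg h hh hgh, map_mul]
  · exact hπ.2 hg hh (e.symm.injective eq)

theorem lefGrowth_le {S : Set Γ} {n : ℕ} {Q : Type*} [Group Q] [Finite Q] {π : Γ → Q}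
    (hπ : IsLocalEmbedding (ball S n) π) : lefGrowth S n ≤ Nat.card Q := by
  obtain ⟨R, _, _, ρ, hρ, hc⟩ := hπ.exists_type
  exact sInf_le ⟨R, ‹_›, ‹_›, ρ, hρ, by rw [hc]⟩

theorem le_lefGrowth {S : Set Γ} {n : ℕ} {k : ℕ∞}
    (h : ∀ (Q : Type) [Group Q] [Finite Q] (π : Γ → Q), IsLocalEmbedding (ball S n) π →
      k ≤ Nat.card Q) : k ≤ lefGrowth S n := by
  refine le_sInf ?_
  rintro _ ⟨Q, _, _, π, hπ, rfl⟩
  exact h Q π hπ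

theorem lefGrowth_zero (S : Set Γ) : lefGrowth S 0 ≤ 1 := by
  have h : IsLocalEmbedding (ball S 0) (fun _ => (1 : Unit)) :=
    ⟨fun _ _ _ _ _ => rfl, fun g hg h hh _ => by rw [mem_ball_zero.1 hg, mem_ball_zero.1 hh]⟩
  simpa using lefGrowth_le h

theorem one_le_lefGrowth (S : Set Γ) (n : ℕ) : 1 ≤ lefGrowth S n :=
  le_lefGrowth fun Q _ _ _ _ => by exact_mod_cast (Nat.card_pos (α := Q))

/-- It suffices to compare `f n` with all `g m` for `m ≥ c * n`, since `⌊C * x⌋₊` need not be a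
multiple of `⌊x⌋₊`. The case `n = 0` is separate: there `m` may be arbitrarily small. -/
theorem Preceq.of_linear {f g : ℕ → ℕ∞} (c : ℕ) (h0 : ∀ m, f 0 ≤ g m)
    (h : ∀ n m, 1 ≤ n → c * n ≤ m → f n ≤ g m) : Preceq f g := by
  refine ⟨c + 1, by positivity, fun x hx => ?_⟩
  rcases Nat.eq_zero_or_pos ⌊x⌋₊ with hn | hn
  · rw [hn]
    exact h0 _
  · refine h _ _ hn (Nat.le_floor ?_)
    push_cast
    have := Nat.floor_le hx.le
    nlinarith [(Nat.cast_nonneg c : (0 : ℝ) ≤ c), (Nat.cast_nonneg ⌊x⌋₊ : (0 : ℝ) ≤ ⌊x⌋₊)]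

end LEFGrowth

/-! ### Transpositions as short elements, and finite generation -/

section Transpositions

variable {Γ Ω : Type*} [Group Γ] [MulAction Γᵐᵒᵖ Ω]

open scoped Classical

/-- The transposition of `x` and `y` (the identity if `x = y`), as an element of `FSym Ω`. -/
noncomputable def transposition (x y : Ω) : FSym Ω :=
  ⟨Equiv.swap x y, (Set.toFinite {x, y}).subset fun ω hω => by
    by_contra h
    simp only [Set.mem_insert_iff, Set.mem_singleton_iff, not_or] at h
    exact hω (Equiv.swap_apply_of_ne_of_ne h.1 h.2)⟩

theorem coe_transposition (x y : Ω) : (transposition x y : Equiv.Perm Ω) = Equiv.swap x y := rfl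

theorem transposition_self (x : Ω) : transposition x x = 1 :=
  Subtype.ext (Equiv.swap_self x)

theorem mul_transposition_mul_inv (σ : FSym Ω) (x y : Ω) :
    σ * transposition x y * σ⁻¹ =
      transposition ((σ : Equiv.Perm Ω) x) ((σ : Equiv.Perm Ω) y) :=
  Subtype.ext (Equiv.swap_apply_apply (σ : Equiv.Perm Ω) x y).symm

theorem conjHom_transposition (g : Γ) (x y : Ω) :
    conjHom Γ Ω g (transposition x y) = transposition (x <• g⁻¹) (y <• g⁻¹) := by
  have h := Equiv.swap_apply_apply (permHom Γ Ω g) x y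
  exact Subtype.ext h.symm

open SemidirectProduct in
theorem inr_inv_mul_transposition_mul_inr (g : Γ) (x y : Ω) :
    (inr g⁻¹ * inl (transposition x y) * inr g : SymEnrichment Γ Ω) =
      inl (transposition (x <• g) (y <• g)) := by
  have h := inl_aut (φ := conjHom Γ Ω) g⁻¹ (transposition x y)
  rw [conjHom_transposition, inv_inv] at h
  exact h.symm

/-- The set consisting of the elements of `S` and the transpositions that move `ω₀` along an edge of
the Schreier graph. It generates the symmetric enrichment if `S` generates `Γ` and the action is
transitive. -/
def enrichmentGens (S : Set Γ) (ω₀ : Ω) : Set (SymEnrichment Γ Ω) :=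
  SemidirectProduct.inr '' S ∪
    ((fun s => SemidirectProduct.inl (transposition ω₀ (ω₀ <• s))) '' S ∪
      (fun s => SemidirectProduct.inl (transposition ω₀ (ω₀ <• s⁻¹))) '' S)

theorem finite_enrichmentGens {S : Set Γ} (hS : S.Finite) (ω₀ : Ω) :
    (enrichmentGens S ω₀).Finite :=
  (hS.image _).union ((hS.image _).union (hS.image _))

open SemidirectProduct in
/-- If `ω = ω' <• g`, then conjugating `(ω₀ ω')` by `g` and by `(ω₀ ω₀g)` gives `(ω₀ ω)`, up to
degenerate cases. -/
theorem inl_transposition_rsmul_mem_ball {V : Set (SymEnrichment Γ Ω)} {ω₀ ω' : Ω} {g : Γ} {n : ℕ}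
    (hg : inr g ∈ ball V 1) (ht : inl (transposition ω₀ (ω₀ <• g)) ∈ ball V 1)
    (h : inl (transposition ω₀ ω') ∈ ball V n) :
    inl (transposition ω₀ (ω' <• g)) ∈ ball V (n + 4) := by
  by_cases h0 : ω' <• g = ω₀
  · rw [h0, transposition_self, map_one]
    exact one_mem_ball _ _
  by_cases h1 : ω' <• g = ω₀ <• g
  · rw [h1]
    exact ball_mono _ (by lia) ht
  have key : (inl (transposition ω₀ (ω' <• g)) : SymEnrichment Γ Ω) =
      inl (transposition ω₀ (ω₀ <• g)) * (inr g⁻¹ * inl (transposition ω₀ ω') * inr g) *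
        (inl (transposition ω₀ (ω₀ <• g)))⁻¹ := by
    rw [inr_inv_mul_transposition_mul_inr, ← map_inv, ← map_mul, ← map_mul,
      mul_transposition_mul_inv]
    simp only [coe_transposition]
    rw [Equiv.swap_apply_right, Equiv.swap_apply_of_ne_of_ne h0 h1]
  rw [key, map_inv]
  exact ball_mono _ (by lia) (mul_mem_ball (mul_mem_ball ht
    (mul_mem_ball (mul_mem_ball (inv_mem_ball hg) h) hg)) (inv_mem_ball ht))

open SemidirectProduct in
theorem inl_transposition_mem_ball {S : Set Γ} {ω₀ ω : Ω} {n : ℕ} (hω : ω ∈ schreierBall S ω₀ n) :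
    inl (transposition ω₀ ω) ∈ ball (enrichmentGens S ω₀) (4 * n) := by
  induction n generalizing ω with
  | zero =>
    rw [show ω = ω₀ from hω, transposition_self, map_one]
    exact one_mem_ball _ _
  | succ n ih =>
    rcases mem_schreierBall_succ.1 hω with h | ⟨ω', h, s, hs, rfl | rfl⟩
    · exact ball_mono _ (by lia) (ih h)
    · exact inl_transposition_rsmul_mem_ball (mem_ball_one (Or.inl ⟨s, hs, rfl⟩))
        (mem_ball_one (Or.inr (Or.inl ⟨s, hs, rfl⟩))) (ih h)
    · refine inl_transposition_rsmul_mem_ball ?_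
        (mem_ball_one (Or.inr (Or.inr ⟨s, hs, rfl⟩))) (ih h)
      rw [map_inv]
      exact inv_mem_ball_one (Or.inl ⟨s, hs, rfl⟩)

open SemidirectProduct in
theorem inl_transposition_mem_ball_of_mem {S : Set Γ} {ω₀ x y : Ω} {n : ℕ}
    (hx : x ∈ schreierBall S ω₀ n) (hy : y ∈ schreierBall S ω₀ n) :
    inl (transposition x y) ∈ ball (enrichmentGens S ω₀) (12 * n) := by
  have hx' := inl_transposition_mem_ball hx
  have hy' := inl_transposition_mem_ball hy
  by_cases hxy : x = y
  · rw [hxy, transposition_self, map_one]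
    exact one_mem_ball _ _
  by_cases h0 : y = ω₀
  · rw [h0, show transposition x ω₀ = transposition ω₀ x from Subtype.ext (Equiv.swap_comm _ _)]
    exact ball_mono _ (by lia) hx'
  have key : (inl (transposition x y) : SymEnrichment Γ Ω) =
      inl (transposition ω₀ x) * inl (transposition ω₀ y) * (inl (transposition ω₀ x))⁻¹ := by
    rw [← map_inv, ← map_mul, ← map_mul, mul_transposition_mul_inv]
    simp only [coe_transposition]
    rw [Equiv.swap_apply_left, Equiv.swap_apply_of_ne_of_ne h0 (Ne.symm hxy)]
  rw [key]
  exact ball_mono _ (by lia) (mul_mem_ball (mul_mem_ball hx' hy') (inv_mem_ball hx'))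

open SemidirectProduct in
theorem eq_top_of_inr_mem_of_transposition_mem {H : Subgroup (SymEnrichment Γ Ω)}
    (h₁ : ∀ g, inr g ∈ H) (h₂ : ∀ x y, inl (transposition x y) ∈ H) : H = ⊤ := by
  have h₃ : ∀ σ : Equiv.Perm Ω, σ ∈ Subgroup.closure {σ : Equiv.Perm Ω | σ.IsSwap} →
      ∃ τ : FSym Ω, (τ : Equiv.Perm Ω) = σ ∧ inl τ ∈ H := by
    intro σ hσ
    induction hσ using Subgroup.closure_induction with
    | mem σ hσ =>
      obtain ⟨x, y, -, rfl⟩ := hσ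
      exact ⟨transposition x y, by rw [coe_transposition], h₂ x y⟩
    | one => exact ⟨1, rfl, by rw [map_one]; exact one_mem H⟩
    | mul a b _ _ iha ihb =>
      obtain ⟨a', rfl, ha⟩ := iha
      obtain ⟨b', rfl, hb⟩ := ihb
      exact ⟨a' * b', rfl, by rw [map_mul]; exact mul_mem ha hb⟩
    | inv a _ ih =>
      obtain ⟨a', rfl, ha⟩ := ih
      exact ⟨a'⁻¹, rfl, by rw [map_inv]; exact inv_mem ha⟩
  refine (Subgroup.eq_top_iff' H).2 fun p => ?_
  rw [← inl_left_mul_inr_right p]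
  refine mul_mem ?_ (h₁ _)
  obtain ⟨τ, hτ, h⟩ := h₃ p.left (mem_closure_isSwap'.2 p.left.2)
  rwa [Subtype.ext hτ] at h

theorem inr_mem_closure {S : Set Γ} (hgen : Subgroup.closure S = ⊤)
    {V : Set (SymEnrichment Γ Ω)} (hV : SemidirectProduct.inr '' S ⊆ V) (g : Γ) :
    SemidirectProduct.inr g ∈ Subgroup.closure V := by
  have h : Subgroup.closure S ≤ (Subgroup.closure V).comap SemidirectProduct.inr :=
    (Subgroup.closure_le _).2 fun s hs => Subgroup.subset_closure (hV ⟨s, hs, rfl⟩)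
  exact h (hgen ▸ Subgroup.mem_top g)

theorem fg_symEnrichment [MulAction.IsPretransitive Γᵐᵒᵖ Ω] {S : Set Γ} (hS : S.Finite)
    (hgen : Subgroup.closure S = ⊤) : Group.FG (SymEnrichment Γ Ω) := by
  rw [Group.fg_iff]
  rcases isEmpty_or_nonempty Ω with hΩ | ⟨⟨ω₀⟩⟩
  · exact ⟨_, eq_top_of_inr_mem_of_transposition_mem (inr_mem_closure hgen subset_rfl)
      fun x => isEmptyElim x, hS.image _⟩
  · refine ⟨enrichmentGens S ω₀, eq_top_of_inr_mem_of_transposition_mem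
      (inr_mem_closure hgen Set.subset_union_left) fun x y => ?_,
      finite_enrichmentGens hS ω₀⟩
    obtain ⟨m, hm⟩ := exists_mem_schreierBall hgen ω₀ x
    obtain ⟨n, hn⟩ := exists_mem_schreierBall hgen ω₀ y
    exact ball_subset_closure _ _ (inl_transposition_mem_ball_of_mem
      (schreierBall_mono S ω₀ (le_max_left m n) hm) (schreierBall_mono S ω₀ (le_max_right m n) hn))

end Transpositions

/-! ### The lower bound: finite groups containing transpositions -/

section LowerBound

open Equiv

/-- Two permutations of a set of at least three points which have the same effect on every
unordered pair are equal. -/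
theorem perm_eq_of_swap_eq {B : Type*} [Fintype B] [DecidableEq B] (hB : 3 ≤ Fintype.card B)
    {σ τ : Perm B} (h : ∀ x y, swap (σ x) (σ y) = swap (τ x) (τ y)) : σ = τ := by
  ext x
  have hmem : ∀ y, y ≠ x → σ x = τ x ∨ σ x = τ y := by
    intro y hy
    by_contra! hne
    have h₁ := swap_apply_of_ne_of_ne hne.1 hne.2
    rw [← h x y, swap_apply_left] at h₁
    exact hy (σ.injective h₁)
  obtain ⟨y, hy, z, hz, hyz⟩ := Finset.one_lt_card.1
    (show 1 < (Finset.univ.erase x).card by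
      rw [Finset.card_erase_of_mem (Finset.mem_univ x), Finset.card_univ]; lia)
  rcases hmem y (Finset.ne_of_mem_erase hy) with h₁ | h₁
  · exact h₁
  rcases hmem z (Finset.ne_of_mem_erase hz) with h₂ | h₂
  · exact h₂
  · exact absurd (τ.injective (h₁.symm.trans h₂)) hyz

/-- A finite group containing elements which are conjugated by one another like the transpositions
of `B` has at least `|B|!` elements: by induction on a factorization into transpositions, every
permutation `σ` of `B` is induced through conjugation by some element of the group, and this
element determines `σ` if `B` has at least three points. -/
theorem factorial_card_le_of_transposition_like {B Q : Type*} [Fintype B] [DecidableEq B] [Group Q]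
    [Finite Q] (t : B → B → Q)
    (hconj : ∀ a b x y, t a b * t x y = t (swap a b x) (swap a b y) * t a b)
    (hinj : ∀ a b x y, t a b = t x y → swap a b = swap x y) :
    (Fintype.card B).factorial ≤ Nat.card Q := by
  rcases Nat.lt_or_ge (Fintype.card B) 3 with hB | hB
  · rcases Nat.lt_or_ge (Fintype.card B) 2 with hB' | hB'
    · rw [Nat.factorial_eq_one.2 (by lia)]
      exact Nat.card_pos
    · rw [show Fintype.card B = 2 by lia, Nat.factorial_two]
      obtain ⟨x, y, hxy⟩ := Fintype.exists_pair_of_one_lt_card hB'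
      have : Nontrivial Q := ⟨t x y, t x x, fun h => hxy (by
        have := hinj _ _ _ _ h
        rw [swap_self] at this
        exact swap_eq_refl_iff.1 this)⟩
      exact Finite.one_lt_card
  · have hex : ∀ σ : Perm B, ∃ q : Q, ∀ x y, q * t x y = t (σ x) (σ y) * q := by
      intro σ
      induction σ using Perm.swap_induction_on with
      | one => exact ⟨1, fun x y => by simp⟩
      | swap_mul σ a b _ ih =>
        obtain ⟨q, hq⟩ := ih
        refine ⟨t a b * q, fun x y => ?_⟩
        rw [mul_assoc, hq, ← mul_assoc, hconj, mul_assoc]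
        rfl
    choose q hq using hex
    have hqinj : Function.Injective q := by
      intro σ τ h
      refine perm_eq_of_swap_eq hB fun x y => hinj _ _ _ _ ?_
      have h₁ := hq σ x y
      rw [h, hq τ x y] at h₁
      exact (mul_right_cancel h₁).symm
    have := Nat.card_le_card_of_injective q hqinj
    rwa [Nat.card_perm, Nat.card_eq_fintype_card] at this

variable {Γ Ω : Type*} [Group Γ] [MulAction Γᵐᵒᵖ Ω]

open SemidirectProduct in
/-- A finite group into which all transpositions of points of `T` and their pairwise products embed
locally has at least `|T|!` elements. -/
theorem factorial_ncard_le_of_isLocalEmbedding {T : Set Ω} (hT : T.Finite)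
    {F : Set (SymEnrichment Γ Ω)} (h₁ : ∀ x ∈ T, ∀ y ∈ T, inl (transposition x y) ∈ F)
    (h₂ : ∀ a ∈ T, ∀ b ∈ T, ∀ x ∈ T, ∀ y ∈ T,
      inl (transposition a b) * inl (transposition x y) ∈ F)
    {Q : Type*} [Group Q] [Finite Q] {π : SymEnrichment Γ Ω → Q} (hπ : IsLocalEmbedding F π) :
    T.ncard.factorial ≤ Nat.card Q := by
  classical
  have := hT.fintype
  have hswap : ∀ a b x : T, Equiv.swap (a : Ω) b x = (swap a b x : T) := by
    intro a b x
    simp only [swap_apply_def, Subtype.ext_iff]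
    split_ifs <;> rfl
  rw [← Nat.card_coe_set_eq, Nat.card_eq_fintype_card]
  refine factorial_card_le_of_transposition_like
    (fun x y : T => π (inl (transposition (x : Ω) (y : Ω)))) (fun a b x y => ?_) fun a b x y h => ?_
  · have key : (inl (transposition (a : Ω) (b : Ω)) * inl (transposition (x : Ω) (y : Ω)) :
        SymEnrichment Γ Ω) =
        inl (transposition ((swap a b x : T) : Ω) ((swap a b y : T) : Ω)) *
          inl (transposition (a : Ω) (b : Ω)) := by
      rw [← map_mul, ← map_mul, ← hswap, ← hswap, mul_inv_eq_iff_eq_mul.1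
        (mul_transposition_mul_inv (transposition (a : Ω) (b : Ω)) x y), coe_transposition]
    have hF := h₂ _ a.2 _ b.2 x x.2 y y.2
    rw [← hπ.1 _ (h₁ a a.2 b b.2) _ (h₁ x x.2 y y.2) hF]
    rw [key] at hF ⊢
    exact hπ.1 _ (h₁ _ (Subtype.coe_prop _) _ (Subtype.coe_prop _)) _ (h₁ a a.2 b b.2) hF
  · have h' := inl_injective (hπ.2 (h₁ a a.2 b b.2) (h₁ x x.2 y y.2) h)
    have h'' : Equiv.swap (a : Ω) b = Equiv.swap (x : Ω) y := by
      simpa [coe_transposition] using congrArg Subtype.val h'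
    ext z
    rw [← hswap, ← hswap, h'']

theorem factorial_schreierGrowth_preceq {S : Set Γ} (hS : S.Finite) (ω₀ : Ω)
    {U : Set (SymEnrichment Γ Ω)} (hU : Subgroup.closure U = ⊤) :
    Preceq (fun n => ((schreierGrowth S ω₀ n).factorial : ℕ∞)) (lefGrowth U) := by
  -- `12 * n` bounds the length of a transposition of points of the ball, `24 * n` that of a product
  -- of two of them, and `k` the length of a generator with respect to `U`.
  obtain ⟨k, hk⟩ := (finite_enrichmentGens hS ω₀).exists_subset_of_monotone (ball_mono U)
    fun g _ => exists_mem_ball hU g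
  refine Preceq.of_linear (k * 24) (fun m => ?_) fun n m _ hm => ?_
  · have : schreierGrowth S ω₀ 0 = 1 := Set.ncard_singleton ω₀
    simpa [this] using one_le_lefGrowth U m
  · refine le_lefGrowth fun Q _ _ π hπ => ?_
    have hsub : ball (enrichmentGens S ω₀) (24 * n) ⊆ ball U m :=
      (ball_subset_ball_mul hk _).trans (ball_mono U (by rwa [← mul_assoc]))
    have := factorial_ncard_le_of_isLocalEmbedding (finite_schreierBall hS ω₀ n)
      (fun x hx y hy => hsub (ball_mono _ (by lia) (inl_transposition_mem_ball_of_mem hx hy)))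
      (fun a ha b hb x hx y hy => hsub (ball_mono _ (by lia) (mul_mem_ball
        (inl_transposition_mem_ball_of_mem ha hb) (inl_transposition_mem_ball_of_mem hx hy)))) hπ
    exact_mod_cast this

end LowerBound

/-! ### The upper bound: transport of permutations along a local embedding -/

section UpperBound

variable {Γ Q Ω X : Type*} [Group Γ] [Group Q] [MulAction Γᵐᵒᵖ Ω] [MulAction Qᵐᵒᵖ X]

open Equiv

theorem apply_mem_of_fixes_compl {T : Set Ω} {σ : Perm Ω} (hσ : ∀ ω ∉ T, σ ω = ω) {ω : Ω}
    (hω : ω ∈ T) : σ ω ∈ T := by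
  by_contra h
  exact h (by rwa [σ.injective (hσ _ h)])

theorem exists_pushforward {T : Set Ω} {θ : Ω → X} (hθ : Set.InjOn θ T) {σ : Perm Ω}
    (hσ : ∀ ω ∉ T, σ ω = ω) :
    ∃ ρ : Perm X, (∀ ω ∈ T, ρ (θ ω) = θ (σ ω)) ∧ ∀ y ∉ θ '' T, ρ y = y := by
  have hT : ∀ ω, σ ω ∈ T ↔ ω ∈ T := by
    intro ω
    by_cases h : ω ∈ T
    · exact iff_of_true (apply_mem_of_fixes_compl hσ h) h
    · rw [hσ ω h]
  let ι : T ↪ X := ⟨fun ω => θ ω, fun a b h => Subtype.ext (hθ a.2 b.2 h)⟩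
  refine ⟨(σ.subtypePerm hT).viaEmbedding ι, fun ω hω => ?_, fun y hy => ?_⟩
  · exact Perm.viaEmbedding_apply (σ.subtypePerm hT) ι ⟨ω, hω⟩
  · refine Perm.viaEmbedding_apply_of_notMem _ ι y ?_
    rintro ⟨ω, rfl⟩
    exact hy ⟨ω, ω.2, rfl⟩

open scoped Classical in
/-- The permutation of `X` obtained by transporting along `θ` a permutation `σ` of `Ω` supported
in `T`, where `θ` is injective on `T`; it fixes all points outside `θ '' T`. The value is `1` if
there is no such permutation. -/
noncomputable def pushforward (T : Set Ω) (θ : Ω → X) (σ : Perm Ω) : Perm X :=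
  if h : ∃ ρ : Perm X, (∀ ω ∈ T, ρ (θ ω) = θ (σ ω)) ∧ ∀ y ∉ θ '' T, ρ y = y then h.choose else 1

theorem pushforward_spec {T : Set Ω} {θ : Ω → X} (hθ : Set.InjOn θ T) {σ : Perm Ω}
    (hσ : ∀ ω ∉ T, σ ω = ω) :
    (∀ ω ∈ T, pushforward T θ σ (θ ω) = θ (σ ω)) ∧
      ∀ y ∉ θ '' T, pushforward T θ σ y = y := by
  have h := exists_pushforward hθ hσ
  rw [pushforward, dif_pos h]
  exact h.choose_spec

theorem pushforward_mul {T : Set Ω} {θ : Ω → X} (hθ : Set.InjOn θ T) {σ τ : Perm Ω}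
    (hσ : ∀ ω ∉ T, σ ω = ω) (hτ : ∀ ω ∉ T, τ ω = ω) :
    pushforward T θ (σ * τ) = pushforward T θ σ * pushforward T θ τ := by
  have hστ : ∀ ω ∉ T, (σ * τ) ω = ω := fun ω hω => by rw [Perm.mul_apply, hτ ω hω, hσ ω hω]
  ext y
  rw [Perm.mul_apply]
  by_cases hy : y ∈ θ '' T
  · obtain ⟨ω, hω, rfl⟩ := hy
    rw [(pushforward_spec hθ hστ).1 ω hω, (pushforward_spec hθ hτ).1 ω hω,
      (pushforward_spec hθ hσ).1 _ (apply_mem_of_fixes_compl hτ hω), Perm.mul_apply]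
  · rw [(pushforward_spec hθ hστ).2 y hy, (pushforward_spec hθ hτ).2 y hy,
      (pushforward_spec hθ hσ).2 y hy]

theorem pushforward_injOn {T : Set Ω} {θ : Ω → X} (hθ : Set.InjOn θ T) :
    Set.InjOn (pushforward T θ) {σ | ∀ ω ∉ T, σ ω = ω} := by
  intro σ hσ τ hτ h
  ext ω
  by_cases hω : ω ∈ T
  · refine hθ (apply_mem_of_fixes_compl hσ hω) (apply_mem_of_fixes_compl hτ hω) ?_
    rw [← (pushforward_spec hθ hσ).1 ω hω, ← (pushforward_spec hθ hτ).1 ω hω, h]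
  · rw [hσ ω hω, hτ ω hω]

theorem pushforward_apply_of_notMem {T₀ T : Set Ω} {θ : Ω → X} (hθ : Set.InjOn θ T) (hT₀ : T₀ ⊆ T)
    {σ : Perm Ω} (hσ : ∀ ω ∉ T₀, σ ω = ω) {y : X} (hy : y ∉ θ '' T₀) :
    pushforward T θ σ y = y := by
  have hσ' : ∀ ω ∉ T, σ ω = ω := fun ω hω => hσ ω fun h => hω (hT₀ h)
  by_cases hy' : y ∈ θ '' T
  · obtain ⟨ω, hω, rfl⟩ := hy'
    rw [(pushforward_spec hθ hσ').1 ω hω, hσ ω fun h => hy ⟨ω, h, rfl⟩]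
  · exact (pushforward_spec hθ hσ').2 y hy'

theorem conjHom_fixes {T₀ T : Set Ω} {τ : FSym Ω} {g : Γ}
    (hτ : ∀ ω ∉ T₀, (τ : Perm Ω) ω = ω) (hT : ∀ ω ∈ T₀, ω <• g⁻¹ ∈ T) :
    ∀ ω ∉ T, (conjHom Γ Ω g τ : Perm Ω) ω = ω := by
  intro ω hω
  rw [conjHom_apply, hτ, rsmul_rsmul_inv]
  intro h
  have := hT _ h
  rw [rsmul_rsmul_inv] at this
  exact hω this

/-- Transport along a local embedding of actions is compatible with conjugation by a group
element `g`, as long as the support and its translate by `g⁻¹` stay in the domain. -/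
theorem pushforward_conjHom {E : Set Γ} {T₀ T : Set Ω} {π : Γ → Q} {θ : Ω → X}
    (h : IsLocalActionEmbedding E T π θ) (hT₀ : T₀ ⊆ T) {g : Γ} (hg : g ∈ E)
    (hT : ∀ ω ∈ T₀, ω <• g⁻¹ ∈ T) {τ : FSym Ω} (hτ : ∀ ω ∉ T₀, (τ : Perm Ω) ω = ω) (y : X) :
    pushforward T θ (conjHom Γ Ω g τ : Perm Ω) y =
      pushforward T θ (τ : Perm Ω) (y <• π g) <• (π g)⁻¹ := by
  have hθ := h.2.1
  have hτ' : ∀ ω ∉ T, (τ : Perm Ω) ω = ω := fun ω hω => hτ ω fun h => hω (hT₀ h)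
  have hc := conjHom_fixes hτ hT
  have hequiv : ∀ ω ∈ T₀, θ ω <• (π g)⁻¹ = θ (ω <• g⁻¹) := by
    intro ω hω
    have := h.2.2 g hg _ (hT ω hω) (by rw [rsmul_inv_rsmul]; exact hT₀ hω)
    rw [rsmul_inv_rsmul] at this
    rw [this, rsmul_rsmul_inv]
  -- The right-hand side moves `y` only if `y <• π g` lies in the transported support; in that case
  -- `y` is the image of a point of `T`.
  by_cases hz : y <• π g ∈ θ '' T₀
  · obtain ⟨ω, hω, hωy⟩ := hz
    have hy : y = θ (ω <• g⁻¹) := by rw [← hequiv ω hω, hωy, rsmul_rsmul_inv]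
    rw [← hωy, (pushforward_spec hθ hτ').1 ω (hT₀ hω),
      hequiv _ (apply_mem_of_fixes_compl hτ hω), hy, (pushforward_spec hθ hc).1 _ (hT ω hω),
      conjHom_apply, rsmul_inv_rsmul]
  · rw [pushforward_apply_of_notMem hθ hT₀ hτ hz, rsmul_rsmul_inv]
    by_cases hy : y ∈ θ '' T
    · obtain ⟨ω, hω, rfl⟩ := hy
      have hω' : ω <• g ∉ T₀ := fun h' => hz ⟨_, h', h.2.2 g hg ω hω (hT₀ h')⟩
      rw [(pushforward_spec hθ hc).1 ω hω, conjHom_apply, hτ _ hω', rsmul_rsmul_inv]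
    · exact (pushforward_spec hθ hc).2 y hy

/-- The map of symmetric enrichments given by `π` on the acting group, and on permutations
supported in `T` by transport along `θ`. -/
noncomputable def enrichmentMap [Finite X] (T : Set Ω) (π : Γ → Q) (θ : Ω → X)
    (p : SymEnrichment Γ Ω) : SymEnrichment Q X :=
  ⟨⟨pushforward T θ p.left, Set.toFinite _⟩, π p.right⟩

theorem isLocalEmbedding_enrichmentMap [Finite X] {F : Set (SymEnrichment Γ Ω)} {E : Set Γ}
    {T₀ T : Set Ω} {π : Γ → Q} {θ : Ω → X} (h : IsLocalActionEmbedding E T π θ) (hT₀ : T₀ ⊆ T)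
    (hE : ∀ p ∈ F, p.right ∈ E) (hF : ∀ p ∈ F, ∀ ω ∉ T₀, (p.left : Perm Ω) ω = ω)
    (hT : ∀ p ∈ F, ∀ ω ∈ T₀, ω <• p.right⁻¹ ∈ T) :
    IsLocalEmbedding F (enrichmentMap T π θ) := by
  have hF' : ∀ p ∈ F, ∀ ω ∉ T, (p.left : Perm Ω) ω = ω :=
    fun p hp ω hω => hF p hp ω fun h => hω (hT₀ h)
  refine ⟨fun p hp q hq hpq => SemidirectProduct.ext (Subtype.ext ?_)
    (h.1.1 _ (hE p hp) _ (hE q hq) (hE _ hpq)), fun p hp q hq hpq => ?_⟩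
  · change pushforward T θ ((p.left : Perm Ω) * (conjHom Γ Ω p.right q.left : Perm Ω)) =
      pushforward T θ p.left *
        (conjHom Q X (π p.right) (enrichmentMap T π θ q).left : Perm X)
    rw [pushforward_mul h.2.1 (hF' p hp) (conjHom_fixes (hF q hq) (hT p hp))]
    congr 1
    ext y
    rw [conjHom_apply, pushforward_conjHom h hT₀ (hE p hp) (hT p hp) (hF q hq)]
    rfl
  · refine SemidirectProduct.ext (Subtype.ext ?_) ?_
    · exact pushforward_injOn h.2.1 (hF' p hp) (hF' q hq)
        (congrArg (fun r => (r.left : Perm X)) hpq)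
    · exact h.1.2 (hE p hp) (hE q hq) (congrArg SemidirectProduct.right hpq)

theorem card_symEnrichment [Finite X] :
    Nat.card (SymEnrichment Q X) = (Nat.card X).factorial * Nat.card Q := by
  have h : FSym X = ⊤ := (Subgroup.eq_top_iff' _).2 fun _ => Set.toFinite _
  rw [SemidirectProduct.card, ← Nat.card_perm, h, Subgroup.card_top]

theorem finite_symEnrichment [Finite Q] [Finite X] : Finite (SymEnrichment Q X) :=
  Finite.of_equiv _ SemidirectProduct.equivProd.symm

variable (Γ Ω) in
/-- The permutation action of the symmetric enrichment, in which both factors act on `Ω`. -/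
def enrichmentPerm : SymEnrichment Γ Ω →* Perm Ω :=
  SemidirectProduct.lift (FSym Ω).subtype (permHom Γ Ω) fun g => by
    ext σ : 1
    rfl

theorem enrichmentPerm_inv_apply (p : SymEnrichment Γ Ω) (ω : Ω) :
    (enrichmentPerm Γ Ω p)⁻¹ ω = (p.left : Perm Ω)⁻¹ ω <• p.right := by
  rw [Perm.inv_eq_iff_eq]
  change ω = (p.left : Perm Ω) (((p.left : Perm Ω)⁻¹ ω <• p.right) <• p.right⁻¹)
  rw [rsmul_rsmul_inv, ← Perm.mul_apply, mul_inv_cancel, Perm.one_apply]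

/-- If some point outside the transported supports has trivial stabilizer, then the local embedding
into the symmetric enrichment remains one after composition with its permutation action. -/
theorem isLocalEmbedding_enrichmentPerm [Finite X] {F : Set (SymEnrichment Γ Ω)} {E : Set Γ}
    {T₀ T : Set Ω} {π : Γ → Q} {θ : Ω → X} (h : IsLocalActionEmbedding E T π θ) (hT₀ : T₀ ⊆ T)
    (hE : ∀ p ∈ F, p.right ∈ E) (hF : ∀ p ∈ F, ∀ ω ∉ T₀, (p.left : Perm Ω) ω = ω)
    (hT : ∀ p ∈ F, ∀ ω ∈ T₀, ω <• p.right⁻¹ ∈ T) {y : X} (hy : y ∉ θ '' T₀)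
    (hfree : ∀ q r : Q, y <• q = y <• r → q = r) :
    IsLocalEmbedding F fun p => enrichmentPerm Q X (enrichmentMap T π θ p) := by
  have hloc := isLocalEmbedding_enrichmentMap h hT₀ hE hF hT
  refine ⟨fun p hp q hq hpq => by simp only [hloc.1 p hp q hq hpq, map_mul],
    fun p hp q hq hpq => hloc.2 hp hq ?_⟩
  -- As `y` is fixed by the permutation components, the inverse of the image of `p` sends it to
  -- `y <• π p.right`, and this determines `π p.right`.
  have hinv : ∀ p ∈ F, (enrichmentPerm Q X (enrichmentMap T π θ p))⁻¹ y = y <• π p.right := by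
    intro p hp
    have : ((enrichmentMap T π θ p).left : Perm X)⁻¹ y = y :=
      Perm.inv_eq_iff_eq.2 (pushforward_apply_of_notMem h.2.1 hT₀ (hF p hp) hy).symm
    rw [enrichmentPerm_inv_apply, this]
    rfl
  have hright : (enrichmentMap T π θ p).right = (enrichmentMap T π θ q).right := by
    refine hfree _ _ ((hinv p hp).symm.trans (Eq.trans ?_ (hinv q hq)))
    exact congrArg (fun ρ : Perm X => ρ⁻¹ y) hpq
  refine SemidirectProduct.ext (Subtype.ext ?_) hright
  have hpq' : ((enrichmentMap T π θ p).left : Perm X) * permHom Q X (enrichmentMap T π θ p).right =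
      (enrichmentMap T π θ q).left * permHom Q X (enrichmentMap T π θ q).right := hpq
  rw [hright] at hpq'
  exact mul_right_cancel hpq'

/-- An element of length at most `n` in the symmetric enrichment has group component of length
at most `c * n`, and permutation component supported in a ball of radius `c * n`. -/
theorem exists_right_mem_ball_and_left_fixes [MulAction.IsPretransitive Γᵐᵒᵖ Ω] {S : Set Γ}
    (hgen : Subgroup.closure S = ⊤) (ω₀ : Ω) {U : Set (SymEnrichment Γ Ω)} (hU : U.Finite) :
    ∃ c, ∀ n, ∀ p ∈ ball U n, p.right ∈ ball S (c * n) ∧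
      ∀ ω ∉ schreierBall S ω₀ (c * n), (p.left : Perm Ω) ω = ω := by
  -- The constant `c` serves for the elements of `U` and their inverses; each further letter then
  -- contributes a support translated by an element of length at most `c * n`.
  obtain ⟨c, hc⟩ := (hU.union (hU.image (·⁻¹))).exists_subset_of_monotone
    (B := fun n => {p : SymEnrichment Γ Ω | p.right ∈ ball S n ∧
      {ω | (p.left : Perm Ω) ω ≠ ω} ⊆ schreierBall S ω₀ n})
    (fun m n hmn p hp => ⟨ball_mono S hmn hp.1, hp.2.trans (schreierBall_mono S ω₀ hmn)⟩)
    (fun p _ => by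
      obtain ⟨m, hm⟩ := exists_mem_ball hgen p.right
      obtain ⟨n, hn⟩ := Set.Finite.exists_subset_of_monotone p.left.2 (schreierBall_mono S ω₀)
        fun ω _ => exists_mem_schreierBall hgen ω₀ ω
      exact ⟨max m n, ball_mono S (le_max_left m n) hm,
        hn.trans (schreierBall_mono S ω₀ (le_max_right m n))⟩)
  have hstep : ∀ (n : ℕ) (p q : SymEnrichment Γ Ω), q ∈ U ∪ (·⁻¹) '' U →
      (p.right ∈ ball S (c * n) ∧
        ∀ ω ∉ schreierBall S ω₀ (c * n), (p.left : Perm Ω) ω = ω) →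
      (p * q).right ∈ ball S (c * (n + 1)) ∧
        ∀ ω ∉ schreierBall S ω₀ (c * (n + 1)), ((p * q).left : Perm Ω) ω = ω := by
    rintro n p q hq ⟨hp, hp'⟩
    obtain ⟨hq, hq'⟩ := hc hq
    refine ⟨mul_mem_ball hp hq, fun ω hω => ?_⟩
    change (p.left : Perm Ω) ((conjHom Γ Ω p.right q.left : Perm Ω) ω) = ω
    rw [conjHom_fixes (T₀ := schreierBall S ω₀ c) (T := schreierBall S ω₀ (c * (n + 1)))
      (fun ω hω => by_contra fun h => hω (hq' h)) (fun ω hω => ?_) ω hω, hp']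
    · exact fun h => hω (schreierBall_mono S ω₀ (by lia) h)
    · exact schreierBall_mono S ω₀ (by lia) (rsmul_mem_schreierBall hω (inv_mem_ball hp))
  refine ⟨c, fun n => ?_⟩
  induction n with
  | zero =>
    intro p hp
    rw [mem_ball_zero.1 hp]
    exact ⟨one_mem_ball _ _, fun ω _ => rfl⟩
  | succ n ih =>
    intro p hp
    rcases mem_ball_succ.1 hp with hp | ⟨q, hq, u, hu, rfl | rfl⟩
    · exact ⟨ball_mono S (by lia) (ih p hp).1,
        fun ω hω => (ih p hp).2 ω fun h => hω (schreierBall_mono S ω₀ (by lia) h)⟩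
    · exact hstep n q u (Or.inl hu) (ih q hq)
    · exact hstep n q u⁻¹ (Or.inr ⟨u, hu, rfl⟩) (ih q hq)

theorem isLEF_symEnrichment (h : IsLEFAction Γ Ω) : IsLEF (SymEnrichment Γ Ω) := by
  intro F hF
  have hT₀ : (⋃ p ∈ F, {ω | (p.left : Perm Ω) ω ≠ ω}).Finite := hF.biUnion fun p _ => p.left.2
  set T₀ := ⋃ p ∈ F, {ω | (p.left : Perm Ω) ω ≠ ω}
  obtain ⟨Q, _, _, X, _, _, π, θ, hπθ⟩ := h (SemidirectProduct.right '' F)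
    (T₀ ∪ Set.image2 (fun ω (p : SymEnrichment Γ Ω) => ω <• p.right⁻¹) T₀ F) (hF.image _)
    (hT₀.union (hT₀.image2 _ hF))
  have := finite_symEnrichment (Q := Q) (X := X)
  refine ⟨_, inferInstance, this, _, isLocalEmbedding_enrichmentMap hπθ Set.subset_union_left
    (fun p hp => ⟨p, hp, rfl⟩) (fun p hp ω hω => ?_) fun p hp ω hω => Or.inr ⟨ω, hω, p, hp, rfl⟩⟩
  by_contra h
  exact hω (Set.mem_biUnion hp h)

theorem lefGrowth_preceq_factorial_mul [MulAction.IsPretransitive Γᵐᵒᵖ Ω] {S : Set Γ}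
    (hgen : Subgroup.closure S = ⊤) (ω₀ : Ω) {U : Set (SymEnrichment Γ Ω)} (hU : U.Finite)
    (Q : ℕ → Type*) (X : ℕ → Type*) [∀ n, Group (Q n)] [∀ n, Finite (Q n)] [∀ n, Finite (X n)]
    [∀ n, MulAction (Q n)ᵐᵒᵖ (X n)] (π : ∀ n, Γ → Q n) (θ : ∀ n, Ω → X n)
    (h : ∀ n, IsLocalActionEmbedding (ball S n) (schreierBall S ω₀ n) (π n) (θ n)) :
    Preceq (lefGrowth U)
      (fun n => (((Nat.card (X n)).factorial * Nat.card (Q n) : ℕ) : ℕ∞)) := by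
  obtain ⟨c, hc⟩ := exists_right_mem_ball_and_left_fixes hgen ω₀ hU
  -- Supports lie in the ball of radius `c * n`, their translates in that of radius `2 * c * n`.
  refine Preceq.of_linear (2 * c) (fun m => (lefGrowth_zero U).trans ?_) fun n m _ hm => ?_
  · exact_mod_cast Nat.mul_pos (Nat.factorial_pos _) Nat.card_pos
  · have := finite_symEnrichment (Q := Q m) (X := X m)
    rw [← card_symEnrichment]
    have hm' : c * n + c * n ≤ m := by lia
    exact lefGrowth_le (isLocalEmbedding_enrichmentMap (h m)
      (schreierBall_mono S ω₀ ((Nat.le_add_right _ _).trans hm'))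
      (fun p hp => ball_mono S ((Nat.le_add_right _ _).trans hm') (hc n p hp).1)
      (fun p hp => (hc n p hp).2) fun p hp ω hω => schreierBall_mono S ω₀ hm'
        (rsmul_mem_schreierBall hω (inv_mem_ball (hc n p hp).1)))

end UpperBound

/-! ### The regular action -/

section RegularAction

variable {Γ : Type*} [Group Γ]

theorem IsLocalEmbedding.isLocalActionEmbedding {Q : Type*} [Group Q] {E F T : Set Γ} {π : Γ → Q}
    (hπ : IsLocalEmbedding F π) (hE : E ⊆ F) (hT : T ⊆ F) : IsLocalActionEmbedding E T π π :=
  ⟨hπ.mono hE, hπ.2.mono hT, fun g hg ω hω h => hπ.1 ω (hT hω) g (hE hg) (hT h)⟩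

theorem IsLEF.isLEFAction (h : IsLEF Γ) : IsLEFAction Γ Γ := by
  intro F T hF hT
  obtain ⟨Q, _, _, π, hπ⟩ := h (F ∪ T) (hF.union hT)
  exact ⟨Q, ‹_›, ‹_›, Q, ‹_›, inferInstance, π, π,
    hπ.isLocalActionEmbedding Set.subset_union_left Set.subset_union_right⟩

theorem exists_lefGrowth_eq_card (h : IsLEF Γ) {S : Set Γ} (hS : S.Finite) (n : ℕ) :
    ∃ (Q : Type) (_ : Group Q) (_ : Finite Q) (π : Γ → Q),
      IsLocalEmbedding (ball S n) π ∧ lefGrowth S n = Nat.card Q := by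
  obtain ⟨Q, _, _, π, hπ⟩ := h (ball S n) (finite_schreierBall hS 1 n)
  exact csInf_mem (s := {k : ℕ∞ | ∃ (Q : Type) (_ : Group Q) (_ : Finite Q) (π : Γ → Q),
    IsLocalEmbedding (ball S n) π ∧ k = (Nat.card Q : ℕ∞)}) ⟨_, Q, ‹_›, ‹_›, π, hπ, rfl⟩

/-- For the regular action of an infinite group, the image of a ball in the finite group `Q` has a
point outside the transported supports, so that the permutations of `Q` alone suffice. -/
theorem lefGrowth_preceq_factorial_lefGrowth [Infinite Γ] (hΓ : IsLEF Γ) {S : Set Γ}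
    (hS : S.Finite) (hgen : Subgroup.closure S = ⊤) {U : Set (SymEnrichment Γ Γ)}
    (hU : U.Finite) : Preceq (lefGrowth U) (fun n => factorial (lefGrowth S n)) := by
  obtain ⟨c, hc⟩ := exists_right_mem_ball_and_left_fixes hgen (1 : Γ) hU
  refine Preceq.of_linear (2 * c + 1) (fun m => (lefGrowth_zero U).trans ?_) fun n m hn hm => ?_
  all_goals
    obtain ⟨Q, _, _, π, hπ, hQ⟩ := exists_lefGrowth_eq_card hΓ hS m
    simp only [hQ, factorial, ENat.map_natCast]
  · exact Nat.one_le_cast.2 (Nat.factorial_pos _)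
  · have hm' : c * n + c * n + 1 ≤ m := by nlinarith
    obtain ⟨g, hg, hg'⟩ := exists_mem_ball_succ_notMem hS hgen (c * n)
    rw [← Nat.card_perm]
    refine lefGrowth_le (isLocalEmbedding_enrichmentPerm (T₀ := ball S (c * n)) (T := ball S m)
      (y := π g) (hπ.isLocalActionEmbedding subset_rfl subset_rfl) (ball_mono S (by lia))
      (fun p hp => ball_mono S (by lia) (hc n p hp).1) (fun p hp => (hc n p hp).2)
      (fun p hp ω hω => ball_mono S (by lia) (mul_mem_ball hω (inv_mem_ball (hc n p hp).1)))
      ?_ fun q r h => mul_left_cancel h)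
    rintro ⟨k, hk, e⟩
    exact hg' (hπ.2 (ball_mono S (by lia) hk) (ball_mono S (by lia) hg) e ▸ hk)

end RegularAction

end LEF

/-! ### Both parts together -/

theorem theorem3p3 :
    (∀ (Γ : Type*) [Group Γ] (Ω : Type*) [MulAction Γᵐᵒᵖ Ω] [MulAction.IsPretransitive Γᵐᵒᵖ Ω]
        (S : Set Γ), S.Finite → Subgroup.closure S = ⊤ →
        LEF.IsLEF Γ → LEF.IsLEFAction Γ Ω →
      Group.FG (LEF.SymEnrichment Γ Ω) ∧
      LEF.IsLEF (LEF.SymEnrichment Γ Ω) ∧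
      ∀ (ω₀ : Ω) (U : Set (LEF.SymEnrichment Γ Ω)), U.Finite → Subgroup.closure U = ⊤ →
        LEF.Preceq (fun n => ((LEF.schreierGrowth S ω₀ n).factorial : ℕ∞)) (LEF.lefGrowth U) ∧
        ∀ (Q : ℕ → Type*) (X : ℕ → Type*) [∀ n, Group (Q n)] [∀ n, Finite (Q n)]
          [∀ n, Finite (X n)] [∀ n, MulAction (Q n)ᵐᵒᵖ (X n)]
          (π : ∀ n, Γ → Q n) (θ : ∀ n, Ω → X n),
          (∀ n, LEF.IsLocalActionEmbedding (LEF.ball S n) (LEF.schreierBall S ω₀ n)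
            (π n) (θ n)) →
          LEF.Preceq (LEF.lefGrowth U)
            (fun n => (((Nat.card (X n)).factorial * Nat.card (Q n) : ℕ) : ℕ∞))) ∧
    (∀ (Γ : Type*) [Group Γ] (S : Set Γ), S.Finite → Subgroup.closure S = ⊤ → LEF.IsLEF Γ →
      Group.FG (LEF.SymEnrichment Γ Γ) ∧
      LEF.IsLEF (LEF.SymEnrichment Γ Γ) ∧
      ∀ U : Set (LEF.SymEnrichment Γ Γ), U.Finite → Subgroup.closure U = ⊤ →
        LEF.Preceq (fun n => ((LEF.wordGrowth S n).factorial : ℕ∞)) (LEF.lefGrowth U) ∧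
        (Infinite Γ →
          LEF.Preceq (LEF.lefGrowth U) (fun n => LEF.factorial (LEF.lefGrowth S n)))) := by
  refine ⟨?_, ?_⟩
  · intro Γ _ Ω _ _ S hS hgen _ hΩ
    exact ⟨LEF.fg_symEnrichment hS hgen, LEF.isLEF_symEnrichment hΩ, fun ω₀ U hU hUgen =>
      ⟨LEF.factorial_schreierGrowth_preceq hS ω₀ hUgen,
        LEF.lefGrowth_preceq_factorial_mul hgen ω₀ hU⟩⟩
  · intro Γ _ S hS hgen hΓ
    exact ⟨LEF.fg_symEnrichment hS hgen, LEF.isLEF_symEnrichment hΓ.isLEFAction,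
      fun U hU hUgen => ⟨LEF.factorial_schreierGrowth_preceq hS 1 hUgen,
        fun _ => LEF.lefGrowth_preceq_factorial_lefGrowth hΓ hS hgen hU⟩⟩
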